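/- **Proposition (Hamiltonian form).** Let $\mathcal S$ be the space of real rapidly decreasing smooth functions on $\mathbb R$, let $\partial=\frac{d}{dx}$, and let $\partial^{-1}$ be the skew-symmetric antiderivative $(\partial^{-1}f)(x)=\frac12\big(\int_{-\infty}^x f\,dy-\int_x^{\infty} f\,dy\big)$; thus $\partial^{-1}g'=g$ for $g\in\mathcal S$. For $m=(m_{11},m_{12},m_{21})\in\mathcal S^3$ let $J=J(m)=(J_{ij})_{1\le i,j\le 3}$ be the matrix operator with entries $$\begin{aligned} J_{11}&=\partial m_{11}\partial^{-1}m_{11}\partial+\tfrac12 m_{12}\partial^{-1}m_{21}+\tfrac12 m_{21}\partial^{-1}m_{12}, & J_{12}&=\partial m_{11}\partial^{-1}m_{12}\partial-m_{12}\partial^{-1}m_{11},\\ J_{13}&=\partial m_{11}\partial^{-1}m_{21}\partial-m_{21}\partial^{-1}m_{11}, & J_{21}&=\partial m_{12}\partial^{-1}m_{11}\partial-m_{11}\partial^{-1}m_{12},\\ J_{22}&=\partial m_{12}\partial^{-1}m_{12}\partial-m_{12}\partial^{-1}m_{12}, & J_{23}&=\partial m_{12}\partial^{-1}m_{21}\partial+2m_{11}\partial^{-1}m_{11}+m_{12}\partial^{-1}m_{21},\\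 J_{31}&=\partial m_{21}\partial^{-1}m_{11}\partial-m_{11}\partial^{-1}m_{21}, & J_{32}&=\partial m_{21}\partial^{-1}m_{12}\partial+2m_{11}\partial^{-1}m_{11}+m_{21}\partial^{-1}m_{12},\\ J_{33}&=\partial m_{21}\partial^{-1}m_{21}\partial-m_{21}\partial^{-1}m_{21}. \end{aligned}$$ Write $\langle\alpha,v\rangle=\int_{\mathbb R}\sum_k\alpha_kv_k\,dx$ and $J'[v]\gamma=\frac{d}{d\varepsilon}\big|_{\varepsilon=0}J(m+\varepsilon v)\gamma$. Call $\alpha\in\mathcal S^3$ *neutral* at $m$ if $$\int_{\mathbb R}(m_{21}\alpha_1-2m_{11}\alpha_2)\,dx=\int_{\mathbb R}(m_{12}\alpha_1-2m_{11}\alpha_3)\,dx=\int_{\mathbb R}(m_{12}\alpha_2-m_{21}\alpha_3)\,dx=0,$$ that is, if the functions to which $\partial^{-1}$ is applied in the terms of the form $a\,\partial^{-1}b$ of $J\alpha$ (after collecting terms) are derivatives of functions in $\mathcal S$. Then: 1. For $m,\alpha,v,\gamma\in\mathcal S^3$, $J\alpha\in\mathcal S^3$, and $J'[v]\gamma$ exists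 (pointwise) and lies in $\mathcal S^3$. 2. $J$ is skew-symmetric: $\langle\alpha,J\beta\rangle=-\langle\beta,J\alpha\rangle$ for all $m,\alpha,\beta\in\mathcal S^3$. 3. $J$ satisfies the Jacobi identity $$\langle\alpha,J'[J\beta]\gamma\rangle+\langle\beta,J'[J\gamma]\alpha\rangle+\langle\gamma,J'[J\alpha]\beta\rangle=0$$ for all $m,\alpha,\beta,\gamma\in\mathcal S^3$ such that at least one of $\alpha,\beta,\gamma$ is neutral at $m$. In this sense $J$ is a Hamiltonian operator. 4. Let $H=\frac12\int_{\mathbb R}(u_{11}^2+u_{12}u_{21}+u_{11,x}^2+u_{12,x}u_{21,x})\,dx$, regarded as a functional of $m$ through $u=(1-\partial^2)^{-1}m$, that is $u_{ij}(x)=\frac12\int_{\mathbb R}e^{-|x-y|}m_{ij}(y)\,dy$. At each $m=u-u_{xx}$ with $u\in\mathcal S^3$ there is a unique $\frac{\delta H}{\delta m}=\big(\frac{\delta H}{\delta m_{11}},\frac{\delta H}{\delta m_{12}},\frac{\delta H}{\delta m_{21}}\big)\in\mathcal S^3$ with $\frac{d}{d\varepsilon}\big|_{\varepsilon=0}H(m+\varepsilon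 v)=\langle\frac{\delta H}{\delta m},v\rangle$ for all $v\in\mathcal S^3$, and it is neutral at $m$. 5. Let $u=(u_{11},u_{12},u_{21})$ be a function of $t\in\mathbb R$ with values in $\mathcal S^3$, $m=u-u_{xx}$, and let $I\subset\mathbb R$. Then $u$ satisfies, for all $t\in I$ and $x\in\mathbb R$, the 3CH system $$\begin{aligned} m_{11,t}&=\tfrac12[m_{11}Q]_x+\tfrac12m_{12}(u_{11,x}u_{21}-u_{11}u_{21,x})-\tfrac12m_{21}(u_{11}u_{12,x}-u_{11,x}u_{12}),\\ m_{12,t}&=\tfrac12[m_{12}Q]_x+m_{11}(u_{11}u_{12,x}-u_{11,x}u_{12})+\tfrac12m_{12}(u_{12,x}u_{21}-u_{12}u_{21,x}),\\ m_{21,t}&=\tfrac12[m_{21}Q]_x+m_{11}(u_{11}u_{21,x}-u_{11,x}u_{21})+\tfrac12m_{21}(u_{12}u_{21,x}-u_{12,x}u_{21}), \end{aligned}\qquad Q=u_{11}^2-u_{11,x}^2+u_{12}u_{21}-u_{12,x}u_{21,x},$$ if and only if it satisfies, for all $t\in I$ and $x\in\mathbb R$, the Hamiltonian system $$(m_{11,t},m_{12,t},m_{21,t})^T=J\Big(\frac{\delta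 H}{\delta m_{11}},\frac{\delta H}{\delta m_{12}},\frac{\delta H}{\delta m_{21}}\Big)^T.$$ Here $m_{ij,t}$ is the pointwise derivative in $t$, and satisfying either system includes its existence. -/

import Mathlib

noncomputable section

namespace ThreeCH

/-- Triples of real functions on the line. The entries `0, 1, 2` of a triple are its
`11`, `12` and `21` components. -/
abbrev Triple : Type := Fin 3 → ℝ → ℝ

/-- Triples of rapidly decreasing smooth functions. -/
abbrev STriple : Type := Fin 3 → SchwartzMap ℝ ℝ

/-- The underlying triple of functions. -/
def STriple.fn (f : STriple) : Triple := fun k x => f k x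

/-- The operator `∂⁻¹`: the skew-symmetric antiderivative
`(∂⁻¹ f)(x) = (1/2) (∫_{-∞}^x f - ∫_x^{∞} f)`.
If `f = g'` with `g` decaying at `±∞` (and `g'` integrable), then `∂⁻¹ f = g`. -/
def antideriv (f : ℝ → ℝ) (x : ℝ) : ℝ :=
  (1 / 2) * ((∫ y in Set.Iic x, f y) - ∫ y in Set.Ioi x, f y)

/-- The operator `a ∂⁻¹ b`. -/
def nl (a b f : ℝ → ℝ) : ℝ → ℝ :=
  fun x => a x * antideriv (fun y => b y * f y) x

/-- The operator `∂ a ∂⁻¹ b ∂`. -/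
def dnl (a b f : ℝ → ℝ) : ℝ → ℝ :=
  deriv (nl a b (deriv f))

/-- The entries of the `3 × 3` matrix operator `J` at `m = (m₁₁, m₁₂, m₂₁)`. -/
def JEntry (m : Triple) : Fin 3 → Fin 3 → (ℝ → ℝ) → (ℝ → ℝ) :=
  let m11 := m 0
  let m12 := m 1
  let m21 := m 2
  ![![fun f x => dnl m11 m11 f x + 1 / 2 * nl m12 m21 f x + 1 / 2 * nl m21 m12 f x,
      fun f x => dnl m11 m12 f x - nl m12 m11 f x,
      fun f x => dnl m11 m21 f x - nl m21 m11 f x],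
    ![fun f x => dnl m12 m11 f x - nl m11 m12 f x,
      fun f x => dnl m12 m12 f x - nl m12 m12 f x,
      fun f x => dnl m12 m21 f x + 2 * nl m11 m11 f x + nl m12 m21 f x],
    ![fun f x => dnl m21 m11 f x - nl m11 m21 f x,
      fun f x => dnl m21 m12 f x + 2 * nl m11 m11 f x + nl m21 m12 f x,
      fun f x => dnl m21 m21 f x - nl m21 m21 f x]]

/-- The matrix operator `J` at `m`, applied to a column `α = (α₁, α₂, α₃)ᵀ`. -/
def J (m α : Triple) : Triple :=
  fun i x => ∑ j, JEntry m i j (α j) x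

/-- The point `m + ε v`. -/
def shift (m v : Triple) (ε : ℝ) : Triple := fun k x => m k x + ε * v k x

/-- The directional derivative `J'[v] γ = d/dε|_{ε = 0} J(m + ε v) γ`. -/
def JDeriv (m v γ : Triple) : Triple :=
  fun k x => deriv (fun ε => J (shift m v ε) γ k x) 0

/-- The pairing `⟨α, v⟩ = ∫ (α₁ v₁ + α₂ v₂ + α₃ v₃) dx`. -/
def pairing (α v : Triple) : ℝ := ∫ x, ∑ k, α k x * v k x

/-- The covector `α` is *neutral* at `m`: the functions
`m₂₁ α₁ - 2 m₁₁ α₂`, `m₁₂ α₁ - 2 m₁₁ α₃` and `m₁₂ α₂ - m₂₁ α₃`, to which `∂⁻¹` is applied in the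
terms `a ∂⁻¹ b` of `J α` (after collecting terms), have zero integral, that is, they are
derivatives of functions decaying at both ends. -/
def Neutral (m α : Triple) : Prop :=
  (∫ x, (m 2 x * α 0 x - 2 * m 0 x * α 1 x)) = 0 ∧
  (∫ x, (m 1 x * α 0 x - 2 * m 0 x * α 2 x)) = 0 ∧
  (∫ x, (m 1 x * α 1 x - m 2 x * α 2 x)) = 0

/-- `(1 - ∂²)⁻¹` on bounded or integrable functions, through its Green function
`(1/2) exp (-|x|)`. -/
def helmholtzInv (f : ℝ → ℝ) (x : ℝ) : ℝ :=
  (1 / 2) * ∫ y, Real.exp (-|x - y|) * f y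

/-- `H = (1/2) ∫ (u₁₁² + u₁₂ u₂₁ + u₁₁,ₓ² + u₁₂,ₓ u₂₁,ₓ) dx` as a functional of `m`, where
`u = (1 - ∂²)⁻¹ m`. -/
def H (m : Triple) : ℝ :=
  let u : Triple := fun k => helmholtzInv (m k)
  (1 / 2) * ∫ x, ((u 0 x) ^ 2 + u 1 x * u 2 x + (deriv (u 0) x) ^ 2 +
    deriv (u 1) x * deriv (u 2) x)

/-- `g = δF/δm` at the point `m`: `d/dε|_{ε = 0} F(m + ε v) = ⟨g, v⟩` for all rapidly decreasing
variations `v`. -/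
def IsVariationalDerivative (F : Triple → ℝ) (m g : Triple) : Prop :=
  ∀ v : STriple, HasDerivAt (fun ε : ℝ => F (shift m v.fn ε)) (pairing g v.fn) 0

/-- `m = u - u_xx`. -/
def momentum (u : Triple) : Triple := fun k x => u k x - deriv (deriv (u k)) x

/-- `u₁₁² - u₁₁,ₓ² + u₁₂ u₂₁ - u₁₂,ₓ u₂₁,ₓ`. -/
def Q (u : Triple) (x : ℝ) : ℝ :=
  (u 0 x) ^ 2 - (deriv (u 0) x) ^ 2 + u 1 x * u 2 x - deriv (u 1) x * deriv (u 2) x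

/-- The right-hand sides of the three evolution equations of the 3CH system. -/
def rhs (u : Triple) : Triple :=
  let m := momentum u
  let u11 := u 0
  let u12 := u 1
  let u21 := u 2
  let m11 := m 0
  let m12 := m 1
  let m21 := m 2
  ![fun x => 1 / 2 * deriv (fun y => m11 y * Q u y) x
      + 1 / 2 * m12 x * (deriv u11 x * u21 x - u11 x * deriv u21 x)
      - 1 / 2 * m21 x * (u11 x * deriv u12 x - deriv u11 x * u12 x),
    fun x => 1 / 2 * deriv (fun y => m12 y * Q u y) x
      + m11 x * (u11 x * deriv u12 x - deriv u11 x * u12 x)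
      + 1 / 2 * m12 x * (deriv u12 x * u21 x - u12 x * deriv u21 x),
    fun x => 1 / 2 * deriv (fun y => m21 y * Q u y) x
      + m11 x * (u11 x * deriv u21 x - deriv u11 x * u21 x)
      + 1 / 2 * m21 x * (u12 x * deriv u21 x - deriv u12 x * u21 x)]

/-- The time-dependent triple `u` solves the 3CH system for all times in `I`. -/
def Solves3CH (I : Set ℝ) (u : ℝ → STriple) : Prop :=
  ∀ t ∈ I, ∀ k x,
    HasDerivAt (fun s => momentum (u s).fn k x) (rhs (u t).fn k x) t

/-- `m = u - u_xx` satisfies `m_t = J δH/δm` for all times in `I`. -/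
def SolvesHamiltonianForm (I : Set ℝ) (u : ℝ → STriple) : Prop :=
  ∀ t ∈ I, ∃ g : STriple,
    IsVariationalDerivative H (momentum (u t).fn) g.fn ∧
    ∀ k x, HasDerivAt (fun s => momentum (u s).fn k x)
      (J (momentum (u t).fn) g.fn k x) t

end ThreeCH

end

/-!
The operator `J` has the form `J α = (m P)' + M m`. Here `P = ∂⁻¹ (∑ₖ mₖ αₖ')`, and `M` is a matrix
whose entries are linear in three further potentials `A, B, C`, obtained by applying `∂⁻¹` to
`m₂₁ α₁ - 2 m₁₁ α₂`, `m₁₂ α₁ - 2 m₁₁ α₃` and `m₁₂ α₂ - m₂₁ α₃`. The matrices `M` form the Lie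
algebra of the quadratic form `m₁₁² + m₁₂ m₂₁`. Everything is derived from the polarisation `polJ m n γ` of
this expression in the two places where `m` enters (`J_fn`).

Since `∂⁻¹ f` has temperate growth for a rapidly decreasing `f`, `polJ` takes rapidly decreasing
values. `J` is quadratic in `m`, so its directional derivative is its polarisation (`JDeriv_fn`).
Integration by parts turns `⟨α, polJ m n γ⟩` into the integral of a bilinear expression in the
densities of `(m, α)` and the potentials of `(n, γ)` (`pairing_polJ`), and this is skew-symmetric
because `∂⁻¹` is (`integral_formDens_swap`).

For the Jacobi identity, skew-symmetry makes `⟨α, J'[v] γ⟩` the integral of an expression local in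
`v` (`pairing_JDeriv`). With `v = J β`, the cyclic sum of these expressions is an exact derivative
(`hasDerivAt_jacobi`), by the invariance of the bilinear form that pairs the potentials `A, B, C`
with their densities. Its primitive is rapidly decreasing up to a multiple of the determinant of the
potentials `A, B, C` of the three columns. Each potential has opposite limits at `±∞`, so this
determinant would leave a boundary term; it tends to zero as soon as one column is neutral
(`tendsto_potDet`).

For the Hamiltonian, every rapidly decreasing `v` is `w - w''` with `w` rapidly decreasing, by the
Fourier transform (`exists_helmholtz_eq`), and the Green function recovers `w` from `v`
(`helmholtzInv_helmholtz`). Hence `H` is a quadratic form in `u`, and its variational derivative is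
`(u₁₁, u₂₁/2, u₁₂/2)`. The potentials of this column are `P = Q/2` and Wronskians of the components
of `u`. They are rapidly decreasing, so the column is neutral, and inserting them into the collected
form of `J` gives the 3CH system (`rhs_eq_J_gradH`).
-/

namespace ThreeCH

open MeasureTheory Filter Set
open scoped SchwartzMap Topology

/-! ### Rapidly decreasing functions -/

theorem tendsto_schwartz_atBot (f : 𝓢(ℝ, ℝ)) : Tendsto f atBot (𝓝 0) :=
  f.tendsto_cocompact.mono_left atBot_le_cocompact

theorem tendsto_schwartz_atTop (f : 𝓢(ℝ, ℝ)) : Tendsto f atTop (𝓝 0) :=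
  f.tendsto_cocompact.mono_left atTop_le_cocompact

/-- The derivative of a rapidly decreasing function. -/
noncomputable abbrev D (f : 𝓢(ℝ, ℝ)) : 𝓢(ℝ, ℝ) := SchwartzMap.derivCLM ℝ ℝ f

theorem hasDerivAt_D (f : 𝓢(ℝ, ℝ)) (x : ℝ) : HasDerivAt f (D f x) x := by
  rw [SchwartzMap.derivCLM_apply]
  exact f.hasDerivAt x

theorem deriv_coe (f : 𝓢(ℝ, ℝ)) : deriv (f : ℝ → ℝ) = D f := by
  funext x
  rw [SchwartzMap.derivCLM_apply]

theorem integral_eq_zero_of_hasDerivAt {f : ℝ → ℝ} (g : 𝓢(ℝ, ℝ))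
    (h : ∀ x, HasDerivAt g (f x) x) : ∫ x, f x = 0 := by
  have hf : f = D g := by rw [← deriv_coe]; funext x; exact (h x).deriv.symm
  exact integral_eq_zero_of_hasDerivAt_of_integrable h (hf ▸ SchwartzMap.integrable _) g.integrable

/-! ### The antiderivative of a rapidly decreasing function -/

theorem antideriv_eq {f : ℝ → ℝ} (hf : Integrable f) (x : ℝ) :
    antideriv f x = (∫ y in Iic x, f y) - (1 / 2) * ∫ y, f y := by
  have h := intervalIntegral.integral_Iic_add_Ioi (b := x) hf.integrableOn hf.integrableOn
  rw [antideriv, ← h]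
  ring

theorem antideriv_add {f g : ℝ → ℝ} (hf : Integrable f) (hg : Integrable g) (x : ℝ) :
    antideriv (fun y => f y + g y) x = antideriv f x + antideriv g x := by
  simp only [antideriv]
  rw [integral_add hf.integrableOn hg.integrableOn, integral_add hf.integrableOn hg.integrableOn]
  ring

theorem antideriv_const_mul (c : ℝ) (f : ℝ → ℝ) (x : ℝ) :
    antideriv (fun y => c * f y) x = c * antideriv f x := by
  simp only [antideriv, integral_const_mul]
  ring

theorem antideriv_coe_add (f g : 𝓢(ℝ, ℝ)) (x : ℝ) :
    antideriv (f + g : 𝓢(ℝ, ℝ)) x = antideriv f x + antideriv g x :=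
  antideriv_add f.integrable g.integrable x

theorem antideriv_coe_smul (c : ℝ) (f : 𝓢(ℝ, ℝ)) (x : ℝ) :
    antideriv (c • f : 𝓢(ℝ, ℝ)) x = c * antideriv f x :=
  antideriv_const_mul c f x

theorem antideriv_coe_sub (f g : 𝓢(ℝ, ℝ)) (x : ℝ) :
    antideriv (f - g : 𝓢(ℝ, ℝ)) x = antideriv f x - antideriv g x := by
  rw [show f - g = f + (-1 : ℝ) • g by module, antideriv_coe_add, antideriv_coe_smul]
  ring

theorem hasDerivAt_antideriv (f : 𝓢(ℝ, ℝ)) (x : ℝ) : HasDerivAt (antideriv f) (f x) x := by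
  have hi : Integrable (f : ℝ → ℝ) := f.integrable
  have h : antideriv f = fun x => (∫ y in (0 : ℝ)..x, f y) +
      ((∫ y in Iic 0, f y) - (1 / 2) * ∫ y, f y) := by
    funext x
    rw [antideriv_eq hi, ← intervalIntegral.integral_Iic_sub_Iic hi.integrableOn hi.integrableOn]
    ring
  rw [h]
  exact (intervalIntegral.integral_hasDerivAt_right (f.continuous.intervalIntegrable _ _)
    (f.continuous.stronglyMeasurableAtFilter _ _) f.continuous.continuousAt).add_const _

theorem tendsto_antideriv_atTop (f : 𝓢(ℝ, ℝ)) :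
    Tendsto (antideriv f) atTop (𝓝 ((1 / 2) * ∫ y, f y)) := by
  have hi : Integrable (f : ℝ → ℝ) := f.integrable
  have h := ((aecover_Iic (μ := volume) (tendsto_id (α := ℝ) (x := atTop))
    ).integral_tendsto_of_countably_generated hi).sub_const ((1 / 2) * ∫ y, f y)
  refine (h.congr fun x => (antideriv_eq hi x).symm).trans (le_of_eq ?_)
  congr 1
  ring

theorem tendsto_antideriv_atBot (f : 𝓢(ℝ, ℝ)) :
    Tendsto (antideriv f) atBot (𝓝 (-((1 / 2) * ∫ y, f y))) := by
  have hi : Integrable (f : ℝ → ℝ) := f.integrable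
  have h := (tendsto_integral_Iic_zero (f := f) (μ := volume) (tendsto_id (α := ℝ) (x := atBot))
    ).sub_const ((1 / 2) * ∫ y, f y)
  refine (h.congr fun x => (antideriv_eq hi x).symm).trans (le_of_eq ?_)
  congr 1
  ring

theorem hasTemperateGrowth_antideriv (f : 𝓢(ℝ, ℝ)) : (antideriv f).HasTemperateGrowth := by
  refine Function.HasTemperateGrowth.of_fderiv (k := 0) (C := ∫ y, ‖f y‖) ?_
    (fun x => (hasDerivAt_antideriv f x).differentiableAt) fun x => ?_
  · have h : fderiv ℝ (antideriv f) = fun x => ContinuousLinearMap.toSpanSingleton ℝ (f x) := by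
      funext x
      exact (hasDerivAt_antideriv f x).hasFDerivAt.fderiv
    rw [h]
    exact ((ContinuousLinearMap.toSpanSingletonCLE (𝕜 := ℝ) (E := ℝ)
      ).toContinuousLinearMap.hasTemperateGrowth).comp f.hasTemperateGrowth
  · have hi : Integrable (fun y => ‖f y‖) := f.integrable.norm
    have h₁ : ‖∫ y in Iic x, f y‖ ≤ ∫ y, ‖f y‖ :=
      (norm_integral_le_integral_norm _).trans
        (setIntegral_le_integral hi (Eventually.of_forall fun _ => norm_nonneg _))
    have h₂ : ‖∫ y in Ioi x, f y‖ ≤ ∫ y, ‖f y‖ :=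
      (norm_integral_le_integral_norm _).trans
        (setIntegral_le_integral hi (Eventually.of_forall fun _ => norm_nonneg _))
    rw [pow_zero, mul_one, antideriv, norm_mul]
    have h₃ := norm_sub_le (∫ y in Iic x, f y) (∫ y in Ioi x, f y)
    norm_num at h₃ ⊢
    simp only [Real.norm_eq_abs] at *
    linarith

/-- A primitive that is rapidly decreasing is the one that `∂⁻¹` selects. -/
theorem antideriv_eq_of_hasDerivAt {f : ℝ → ℝ} (g : 𝓢(ℝ, ℝ)) (h : ∀ x, HasDerivAt g (f x) x) :
    antideriv f = g := by
  have hf : f = D g := by rw [← deriv_coe]; funext x; exact (h x).deriv.symm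
  have hi : Integrable f := hf ▸ SchwartzMap.integrable _
  funext x
  rw [antideriv, integral_Iic_of_hasDerivAt_of_tendsto' (fun y _ => h y) hi.integrableOn
      (tendsto_schwartz_atBot g),
    integral_Ioi_of_hasDerivAt_of_tendsto' (fun y _ => h y) hi.integrableOn
      (tendsto_schwartz_atTop g)]
  ring

/-! ### Products with rapidly decreasing functions -/

/-- The product `a f` of a rapidly decreasing function `a` and a function `f` of temperate growth
(the value is junk for other `f`). -/
noncomputable def tmul (a : 𝓢(ℝ, ℝ)) (f : ℝ → ℝ) : 𝓢(ℝ, ℝ) := SchwartzMap.smulLeftCLM ℝ f a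

theorem tmul_apply (a : 𝓢(ℝ, ℝ)) {f : ℝ → ℝ} (hf : f.HasTemperateGrowth) (x : ℝ) :
    tmul a f x = a x * f x := by
  rw [tmul, SchwartzMap.smulLeftCLM_apply_apply hf, smul_eq_mul, mul_comm]

@[simp]
theorem tmul_coe_apply (a b : 𝓢(ℝ, ℝ)) (x : ℝ) : tmul a b x = a x * b x :=
  tmul_apply a b.hasTemperateGrowth x

@[simp]
theorem tmul_antideriv_apply (a f : 𝓢(ℝ, ℝ)) (x : ℝ) :
    tmul a (antideriv f) x = a x * antideriv f x :=
  tmul_apply a (hasTemperateGrowth_antideriv f) x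

theorem D_tmul_apply (a b : 𝓢(ℝ, ℝ)) (x : ℝ) : D (tmul a b) x = D a x * b x + a x * D b x := by
  rw [SchwartzMap.derivCLM_apply, show (tmul a b : ℝ → ℝ) = _ from funext (tmul_coe_apply a b)]
  exact ((hasDerivAt_D a x).fun_mul (hasDerivAt_D b x)).deriv

theorem D_tmul_antideriv (a f : 𝓢(ℝ, ℝ)) (x : ℝ) :
    D (tmul a (antideriv f)) x = D a x * antideriv f x + a x * f x := by
  have h : (tmul a (antideriv f) : ℝ → ℝ) = fun x => a x * antideriv f x :=
    funext (tmul_antideriv_apply a f)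
  rw [SchwartzMap.derivCLM_apply, h]
  exact ((hasDerivAt_D a x).fun_mul (hasDerivAt_antideriv f x)).deriv

theorem integrable_mul_antideriv (f g : 𝓢(ℝ, ℝ)) :
    Integrable (fun x => f x * antideriv g x) := by
  simpa only [← tmul_antideriv_apply] using (tmul f (antideriv g)).integrable

/-- The antiderivative `∂⁻¹` is skew-symmetric: the boundary values of `∂⁻¹ f · ∂⁻¹ g` at `±∞`
agree. -/
theorem integral_mul_antideriv (f g : 𝓢(ℝ, ℝ)) :
    ∫ x, f x * antideriv g x = -∫ x, g x * antideriv f x := by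
  have h₁ := integrable_mul_antideriv f g
  have h₂ := integrable_mul_antideriv g f
  have hd : ∀ x, HasDerivAt (fun x => antideriv f x * antideriv g x)
      (f x * antideriv g x + g x * antideriv f x) x := fun x => by
    refine ((hasDerivAt_antideriv f x).fun_mul (hasDerivAt_antideriv g x)).congr_deriv ?_
    ring
  have h := integral_of_hasDerivAt_of_tendsto hd (h₁.add h₂)
    ((tendsto_antideriv_atBot f).mul (tendsto_antideriv_atBot g))
    ((tendsto_antideriv_atTop f).mul (tendsto_antideriv_atTop g))
  rw [integral_add h₁ h₂, neg_mul_neg, sub_self] at h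
  linarith

/-! ### The Helmholtz operator -/

open FourierTransform LineDeriv in
/-- The Helmholtz operator maps onto the rapidly decreasing functions: its inverse is the
Fourier multiplier `(1 + (2πξ)²)⁻¹`. -/
theorem exists_helmholtz_eq (v : 𝓢(ℝ, ℝ)) : ∃ w : 𝓢(ℝ, ℝ), v = w - D (D w) := by
  let q : ℝ → ℝ := fun ξ => (1 + ‖2 * Real.pi * ξ‖ ^ 2) ^ (-1 : ℝ)
  have hq : q.HasTemperateGrowth :=
    (Function.hasTemperateGrowth_one_add_norm_sq_rpow ℝ (-1)).comp
      ((Function.HasTemperateGrowth.const (2 * Real.pi)).mul Function.HasTemperateGrowth.id)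
  let V : 𝓢(ℝ, ℂ) := SchwartzMap.postcompCLM (𝕜 := ℝ) Complex.ofRealCLM v
  let W : 𝓢(ℝ, ℂ) := 𝓕⁻ (SchwartzMap.smulLeftCLM ℂ q (𝓕 V))
  have hin : Function.HasTemperateGrowth (fun ξ : ℝ => inner ℝ ξ (1 : ℝ)) := by fun_prop
  have hW : V = W - ∂_{(1 : ℝ)} (∂_{(1 : ℝ)} W) := by
    have : 𝓕 V = 𝓕 (W - ∂_{(1 : ℝ)} (∂_{(1 : ℝ)} W)) := by
      rw [sub_eq_add_neg, FourierTransform.fourier_add, FourierTransform.fourier_neg,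
        SchwartzMap.fourier_lineDerivOp_eq, SchwartzMap.fourier_lineDerivOp_eq]
      ext ξ
      have h0 : (1 + (2 * Real.pi * ξ) ^ 2 : ℝ) ≠ 0 := by positivity
      have h0' : (1 + (2 * Real.pi * ξ) ^ 2 : ℂ) ≠ 0 := by exact_mod_cast h0
      have hqξ : q ξ = (1 + (2 * Real.pi * ξ) ^ 2)⁻¹ := by
        simp only [q, Real.rpow_neg_one, Real.norm_eq_abs, sq_abs]
      simp only [W, fourier_fourierInv_eq, add_apply, neg_apply,
        smul_apply, SchwartzMap.smulLeftCLM_apply_apply hin,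
        SchwartzMap.smulLeftCLM_apply_apply hq, hqξ, smul_eq_mul, Complex.real_smul]
      simp only [conj_trivial, RCLike.inner_apply, one_mul, Complex.ofReal_inv, Complex.ofReal_add,
        Complex.ofReal_one, Complex.ofReal_pow, Complex.ofReal_mul, Complex.ofReal_ofNat]
      linear_combination (-𝓕 V ξ) * inv_mul_cancel₀ h0' +
        4 * (Real.pi : ℂ) ^ 2 * (ξ : ℂ) ^ 2 * (1 + (2 * Real.pi * ξ) ^ 2 : ℂ)⁻¹ * 𝓕 V ξ *
          Complex.I_sq
    simpa using congrArg (fun f => 𝓕⁻ f) this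
  refine ⟨SchwartzMap.postcompCLM (𝕜 := ℝ) Complex.reCLM W, ?_⟩
  have hline : ∀ f : 𝓢(ℝ, ℂ), D (SchwartzMap.postcompCLM (𝕜 := ℝ) Complex.reCLM f) =
      SchwartzMap.postcompCLM (𝕜 := ℝ) Complex.reCLM (∂_{(1 : ℝ)} f) := by
    intro f
    ext x
    rw [SchwartzMap.derivCLM_apply, SchwartzMap.postcompCLM_apply, SchwartzMap.lineDerivOp_apply]
    have h : lineDeriv ℝ f x 1 = deriv f x := by
      rw [(f.hasDerivAt x).hasFDerivAt.hasLineDerivAt 1 |>.lineDeriv]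
      simp
    rw [h]
    exact (Complex.reCLM.hasFDerivAt.comp_hasDerivAt x (f.hasDerivAt x)).deriv
  rw [hline, hline, ← map_sub, ← hW]
  ext x
  simp [V]

/-- The Green function `(1/2) exp (-|x|)` inverts the Helmholtz operator. -/
theorem helmholtzInv_helmholtz (u : 𝓢(ℝ, ℝ)) :
    helmholtzInv (fun y => u y - D (D u) y) = u := by
  have hexp : ∀ x : ℝ, Integrable (fun y => Real.exp (-|x - y|) * (u y - D (D u) y)) := fun x => by
    refine (u - D (D u)).integrable.bdd_mul (c := 1) (by fun_prop)
      (Eventually.of_forall fun y => ?_)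
    rw [Real.norm_eq_abs, abs_of_pos (Real.exp_pos _), Real.exp_le_one_iff]
    exact neg_nonpos.2 (abs_nonneg _)
  have hL : ∀ x, ∫ y in Iic x, Real.exp (-|x - y|) * (u y - D (D u) y) = u x - D u x := fun x => by
    have hEq : EqOn (fun y => Real.exp (-|x - y|) * (u y - D (D u) y))
        (fun y => Real.exp (y - x) * (u y - D (D u) y)) (Iic x) := fun y hy => by
      have : |x - y| = x - y := abs_of_nonneg (sub_nonneg.2 hy)
      simp only [this, neg_sub]
    have hd : ∀ y ∈ Iic x, HasDerivAt (fun y => Real.exp (y - x) * (u y - D u y))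
        (Real.exp (y - x) * (u y - D (D u) y)) y := fun y _ => by
      refine ((((hasDerivAt_id y).sub_const x).exp).fun_mul
        ((hasDerivAt_D u y).fun_sub (hasDerivAt_D (D u) y))).congr_deriv ?_
      simp only [id]
      ring
    have ht : Tendsto (fun y => Real.exp (y - x) * (u y - D u y)) atBot (𝓝 0) := by
      have h1 : Tendsto (fun y => Real.exp (y - x)) atBot (𝓝 0) :=
        Real.tendsto_exp_atBot.comp (tendsto_atBot_add_const_right _ _ tendsto_id)
      simpa using h1.mul ((tendsto_schwartz_atBot u).sub (tendsto_schwartz_atBot (D u)))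
    rw [setIntegral_congr_fun measurableSet_Iic hEq, integral_Iic_of_hasDerivAt_of_tendsto' hd
      ((hexp x).integrableOn.congr_fun hEq measurableSet_Iic) ht]
    simp
  have hR : ∀ x, ∫ y in Ioi x, Real.exp (-|x - y|) * (u y - D (D u) y) = u x + D u x := fun x => by
    have hEq : EqOn (fun y => Real.exp (-|x - y|) * (u y - D (D u) y))
        (fun y => Real.exp (x - y) * (u y - D (D u) y)) (Ioi x) := fun y hy => by
      have : |x - y| = -(x - y) := abs_of_nonpos (sub_nonpos.2 (le_of_lt hy))
      simp only [this, neg_neg]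
    have hd : ∀ y ∈ Ici x, HasDerivAt (fun y => -(Real.exp (x - y) * (u y + D u y)))
        (Real.exp (x - y) * (u y - D (D u) y)) y := fun y _ => by
      refine ((((hasDerivAt_id y).const_sub x).exp).fun_mul
        ((hasDerivAt_D u y).fun_add (hasDerivAt_D (D u) y))).fun_neg.congr_deriv ?_
      simp only [id]
      ring
    have ht : Tendsto (fun y => -(Real.exp (x - y) * (u y + D u y))) atTop (𝓝 0) := by
      have h1 : Tendsto (fun y => Real.exp (x - y)) atTop (𝓝 0) :=
        Real.tendsto_exp_atBot.comp
          (tendsto_atBot_add_const_left _ _ tendsto_neg_atTop_atBot)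
      simpa using (h1.mul ((tendsto_schwartz_atTop u).add (tendsto_schwartz_atTop (D u)))).neg
    rw [setIntegral_congr_fun measurableSet_Ioi hEq, integral_Ioi_of_hasDerivAt_of_tendsto' hd
      ((hexp x).integrableOn.congr_fun hEq measurableSet_Ioi) ht]
    simp
  funext x
  rw [helmholtzInv, ← intervalIntegral.integral_Iic_add_Ioi (b := x) (hexp x).integrableOn
    (hexp x).integrableOn, hL, hR]
  ring

/-! ### The operator in collected form -/

/-- The density `∑ₖ nₖ γₖ'` to which `∂⁻¹` is applied in the terms `∂ m ∂⁻¹ n ∂` of `J γ`. -/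
noncomputable def densP (n γ : STriple) : 𝓢(ℝ, ℝ) :=
  tmul (n 0) (D (γ 0)) + tmul (n 1) (D (γ 1)) + tmul (n 2) (D (γ 2))

/-- The density `n₂₁ γ₁ - 2 n₁₁ γ₂`. -/
noncomputable def densA (n γ : STriple) : 𝓢(ℝ, ℝ) :=
  tmul (n 2) (γ 0) - (2 : ℝ) • tmul (n 0) (γ 1)

/-- The density `n₁₂ γ₁ - 2 n₁₁ γ₃`. -/
noncomputable def densB (n γ : STriple) : 𝓢(ℝ, ℝ) :=
  tmul (n 1) (γ 0) - (2 : ℝ) • tmul (n 0) (γ 2)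

/-- The density `n₁₂ γ₂ - n₂₁ γ₃`. -/
noncomputable def densC (n γ : STriple) : 𝓢(ℝ, ℝ) :=
  tmul (n 1) (γ 1) - tmul (n 2) (γ 2)

theorem densP_apply (n γ : STriple) (x : ℝ) :
    densP n γ x = n 0 x * D (γ 0) x + n 1 x * D (γ 1) x + n 2 x * D (γ 2) x := by
  simp only [densP, add_apply, tmul_coe_apply]

theorem densA_apply (n γ : STriple) (x : ℝ) :
    densA n γ x = n 2 x * γ 0 x - 2 * n 0 x * γ 1 x := by
  simp only [densA, sub_apply, smul_apply, tmul_coe_apply, smul_eq_mul, mul_assoc]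

theorem densB_apply (n γ : STriple) (x : ℝ) :
    densB n γ x = n 1 x * γ 0 x - 2 * n 0 x * γ 2 x := by
  simp only [densB, sub_apply, smul_apply, tmul_coe_apply, smul_eq_mul, mul_assoc]

theorem densC_apply (n γ : STriple) (x : ℝ) :
    densC n γ x = n 1 x * γ 1 x - n 2 x * γ 2 x := by
  simp only [densC, sub_apply, tmul_coe_apply]

/-- The potential `P = ∂⁻¹ (∑ₖ nₖ γₖ')`. -/
noncomputable abbrev potP (n γ : STriple) : ℝ → ℝ := antideriv (densP n γ)

/-- The potential `A = ∂⁻¹ (n₂₁ γ₁ - 2 n₁₁ γ₂)`. -/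
noncomputable abbrev potA (n γ : STriple) : ℝ → ℝ := antideriv (densA n γ)

/-- The potential `B = ∂⁻¹ (n₁₂ γ₁ - 2 n₁₁ γ₃)`. -/
noncomputable abbrev potB (n γ : STriple) : ℝ → ℝ := antideriv (densB n γ)

/-- The potential `C = ∂⁻¹ (n₁₂ γ₂ - n₂₁ γ₃)`. -/
noncomputable abbrev potC (n γ : STriple) : ℝ → ℝ := antideriv (densC n γ)

/-- The operator `J` with its terms collected, polarised in its two occurrences of `m`: the outer
one is `m`, the one inside `∂⁻¹` is `n`. Its entries are `(mₖ P)' + (M m)ₖ`, where the potentials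
`P, A, B, C` belong to `n, γ` and the matrix `M` with entries linear in `A, B, C` ranges over the
infinitesimal symmetries of the quadratic form `m₁₁² + m₁₂ m₂₁`. -/
noncomputable def polJ (m n γ : STriple) : STriple :=
  ![D (tmul (m 0) (potP n γ)) +
      (1 / 2 : ℝ) • (tmul (m 1) (potA n γ) + tmul (m 2) (potB n γ)),
    D (tmul (m 1) (potP n γ)) - tmul (m 0) (potB n γ) - tmul (m 1) (potC n γ),
    D (tmul (m 2) (potP n γ)) - tmul (m 0) (potA n γ) + tmul (m 2) (potC n γ)]

theorem polJ_zero_apply (m n γ : STriple) (x : ℝ) :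
    polJ m n γ 0 x = D (m 0) x * potP n γ x + m 0 x * densP n γ x +
      1 / 2 * (m 1 x * potA n γ x + m 2 x * potB n γ x) := by
  simp only [polJ, Matrix.cons_val, add_apply, smul_apply, smul_eq_mul, D_tmul_antideriv,
    tmul_antideriv_apply]

theorem polJ_one_apply (m n γ : STriple) (x : ℝ) :
    polJ m n γ 1 x = D (m 1) x * potP n γ x + m 1 x * densP n γ x -
      m 0 x * potB n γ x - m 1 x * potC n γ x := by
  simp only [polJ, Matrix.cons_val, sub_apply, D_tmul_antideriv, tmul_antideriv_apply]

theorem polJ_two_apply (m n γ : STriple) (x : ℝ) :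
    polJ m n γ 2 x = D (m 2) x * potP n γ x + m 2 x * densP n γ x -
      m 0 x * potA n γ x + m 2 x * potC n γ x := by
  simp only [polJ, Matrix.cons_val, sub_apply, add_apply, D_tmul_antideriv, tmul_antideriv_apply]

theorem nl_coe (a b f : 𝓢(ℝ, ℝ)) (x : ℝ) :
    nl a b f x = a x * antideriv (tmul b f) x := by
  rw [nl, show (tmul b f : ℝ → ℝ) = fun y => b y * f y from funext (tmul_coe_apply b f)]

theorem dnl_coe (a b f : 𝓢(ℝ, ℝ)) (x : ℝ) :
    dnl a b f x = D a x * antideriv (tmul b (D f)) x + a x * (b x * D f x) := by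
  rw [dnl, deriv_coe, show nl a b (D f) = tmul a (antideriv (tmul b (D f))) by
    funext y; rw [nl_coe, tmul_antideriv_apply], deriv_coe, D_tmul_antideriv, tmul_coe_apply]

theorem fn_apply (f : STriple) (k : Fin 3) : f.fn k = f k := rfl

theorem J_fn (m α : STriple) : J m.fn α.fn = (polJ m m α).fn := by
  funext k x
  fin_cases k
  all_goals
    simp only [J, JEntry, Fin.sum_univ_three, fn_apply, Fin.zero_eta, Fin.mk_one, Fin.reduceFinMk,
      Matrix.cons_val, dnl_coe, nl_coe, polJ_zero_apply, polJ_one_apply, polJ_two_apply, potP,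
      potA, potB, potC, densP_apply]
    simp only [densP, densA, densB, densC, antideriv_coe_add, antideriv_coe_sub,
      antideriv_coe_smul]
    ring

/-! ### The directional derivative -/

theorem shift_fn (m v : STriple) (ε : ℝ) : shift m.fn v.fn ε = STriple.fn (m + ε • v) := rfl

theorem polJ_add_smul_left (m v n γ : STriple) (ε : ℝ) (k : Fin 3) (x : ℝ) :
    polJ (m + ε • v) n γ k x = polJ m n γ k x + ε * polJ v n γ k x := by
  fin_cases k
  all_goals
    simp only [Fin.zero_eta, Fin.mk_one, Fin.reduceFinMk, polJ_zero_apply, polJ_one_apply,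
      polJ_two_apply, Pi.add_apply, Pi.smul_apply, map_add, map_smul, add_apply, smul_apply,
      smul_eq_mul]
    ring

theorem tmul_add_smul (a b f : 𝓢(ℝ, ℝ)) (ε : ℝ) :
    tmul (a + ε • b) f = tmul a f + ε • tmul b f := by
  simp only [tmul, map_add, map_smul]

theorem polJ_add_smul_right (m n v γ : STriple) (ε : ℝ) (k : Fin 3) (x : ℝ) :
    polJ m (n + ε • v) γ k x = polJ m n γ k x + ε * polJ m v γ k x := by
  have hP : densP (n + ε • v) γ = densP n γ + ε • densP v γ := by
    simp only [densP, Pi.add_apply, Pi.smul_apply, tmul_add_smul]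
    module
  have hA : densA (n + ε • v) γ = densA n γ + ε • densA v γ := by
    simp only [densA, Pi.add_apply, Pi.smul_apply, tmul_add_smul]
    module
  have hB : densB (n + ε • v) γ = densB n γ + ε • densB v γ := by
    simp only [densB, Pi.add_apply, Pi.smul_apply, tmul_add_smul]
    module
  have hC : densC (n + ε • v) γ = densC n γ + ε • densC v γ := by
    simp only [densC, Pi.add_apply, Pi.smul_apply, tmul_add_smul]
    module
  fin_cases k
  all_goals
    simp only [Fin.zero_eta, Fin.mk_one, Fin.reduceFinMk, polJ_zero_apply, polJ_one_apply,
      polJ_two_apply, potP, potA, potB, potC, hP, hA, hB, hC, antideriv_coe_add,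
      antideriv_coe_smul, add_apply, smul_apply, smul_eq_mul]
    ring

theorem hasDerivAt_quadratic (a b c : ℝ) :
    HasDerivAt (fun ε : ℝ => a + ε * b + ε ^ 2 * c) b 0 := by
  refine ((((hasDerivAt_id (0 : ℝ)).mul_const b).const_add a).fun_add
    (((hasDerivAt_id (0 : ℝ)).fun_pow 2).mul_const c)).congr_deriv ?_
  simp

/-- `J` is quadratic in `m`, so its directional derivative is its polarisation. -/
theorem hasDerivAt_J_shift (m v γ : STriple) (k : Fin 3) (x : ℝ) :
    HasDerivAt (fun ε : ℝ => J (shift m.fn v.fn ε) γ.fn k x)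
      ((polJ v m γ + polJ m v γ) k x) 0 := by
  have h : (fun ε : ℝ => J (shift m.fn v.fn ε) γ.fn k x) = fun ε =>
      polJ m m γ k x + ε * (polJ v m γ + polJ m v γ) k x + ε ^ 2 * polJ v v γ k x := by
    funext ε
    rw [shift_fn, J_fn, STriple.fn, polJ_add_smul_left, polJ_add_smul_right, polJ_add_smul_right,
      Pi.add_apply, add_apply]
    ring
  rw [h]
  exact hasDerivAt_quadratic _ _ _

theorem JDeriv_fn (m v γ : STriple) :
    JDeriv m.fn v.fn γ.fn = STriple.fn (polJ v m γ + polJ m v γ) := by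
  funext k x
  exact (hasDerivAt_J_shift m v γ k x).deriv

/-! ### Skew-symmetry -/

theorem integrable_sum_mul (α w : STriple) : Integrable (fun x => ∑ k, α k x * w k x) := by
  simpa only [← tmul_coe_apply] using
    integrable_finsetSum Finset.univ fun k _ => (tmul (α k) (w k)).integrable

/-- The integrand `α · M m` contributed to `⟨α, J γ⟩` by the terms `a ∂⁻¹ b` of `J`, with the two
occurrences of `m` in `J` polarised: as `M` is linear in the potentials `A, B, C` of `n, γ`, it is a
bilinear form in these and the densities of `m, α`, and this form is symmetric. -/
noncomputable def rotDens (m α n γ : STriple) : 𝓢(ℝ, ℝ) :=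
  (1 / 2 : ℝ) • (tmul (densB m α) (potA n γ) + tmul (densA m α) (potB n γ)) -
    tmul (densC m α) (potC n γ)

theorem rotDens_apply (m α n γ : STriple) (x : ℝ) :
    rotDens m α n γ x = 1 / 2 * (densB m α x * potA n γ x + densA m α x * potB n γ x) -
      densC m α x * potC n γ x := by
  simp only [rotDens, sub_apply, add_apply, smul_apply, smul_eq_mul, tmul_antideriv_apply]

/-- The integrand of `⟨α, J γ⟩` after integration by parts, with the two occurrences of `m` in `J`
polarised. -/
noncomputable def formDens (m α n γ : STriple) : 𝓢(ℝ, ℝ) :=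
  rotDens m α n γ - tmul (densP m α) (potP n γ)

theorem formDens_apply (m α n γ : STriple) (x : ℝ) :
    formDens m α n γ x =
      1 / 2 * (densB m α x * potA n γ x + densA m α x * potB n γ x) -
        densC m α x * potC n γ x - densP m α x * potP n γ x := by
  simp only [formDens, sub_apply, rotDens_apply, tmul_antideriv_apply]

theorem pairing_polJ (m α n γ : STriple) :
    pairing α.fn (polJ m n γ).fn = ∫ x, formDens m α n γ x := by
  let g := tmul (tmul (α 0) (m 0) + tmul (α 1) (m 1) + tmul (α 2) (m 2)) (potP n γ)
  have hg : ∀ x, D g x = (∑ k, α k x * polJ m n γ k x) - formDens m α n γ x := fun x => by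
    have hf : (g : ℝ → ℝ) = fun x =>
        (α 0 x * m 0 x + α 1 x * m 1 x + α 2 x * m 2 x) * potP n γ x := by
      funext y
      simp only [g, tmul_antideriv_apply, add_apply, tmul_coe_apply]
    have hk := fun k => (hasDerivAt_D (α k) x).fun_mul (hasDerivAt_D (m k) x)
    rw [SchwartzMap.derivCLM_apply, hf, ((((hk 0).fun_add (hk 1)).fun_add (hk 2)).fun_mul
      (hasDerivAt_antideriv (densP n γ) x)).deriv, Fin.sum_univ_three, polJ_zero_apply,
      polJ_one_apply, polJ_two_apply, formDens_apply, densA_apply m, densB_apply m, densC_apply m,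
      densP_apply m]
    ring
  have h : ∀ x, (∑ k, α k x * polJ m n γ k x) = formDens m α n γ x + D g x := fun x => by
    rw [hg]; ring
  rw [pairing]
  simp only [STriple.fn, h]
  rw [integral_add (SchwartzMap.integrable _) (SchwartzMap.integrable _),
    integral_eq_zero_of_hasDerivAt g (hasDerivAt_D g), add_zero]

theorem integral_formDens_swap (m α n γ : STriple) :
    ∫ x, formDens m α n γ x = -∫ x, formDens n γ m α x := by
  have h : ∀ m α n γ : STriple, ∫ x, formDens m α n γ x =
      1 / 2 * ((∫ x, densB m α x * potA n γ x) + ∫ x, densA m α x * potB n γ x) -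
        (∫ x, densC m α x * potC n γ x) - ∫ x, densP m α x * potP n γ x := fun m α n γ => by
    have hB := integrable_mul_antideriv (densB m α) (densA n γ)
    have hA := integrable_mul_antideriv (densA m α) (densB n γ)
    have hC := integrable_mul_antideriv (densC m α) (densC n γ)
    have hP := integrable_mul_antideriv (densP m α) (densP n γ)
    simp only [formDens_apply]
    have hAB : Integrable (fun x =>
        1 / 2 * (densB m α x * potA n γ x + densA m α x * potB n γ x)) :=
      (hB.add hA).const_mul _
    have hABC : Integrable (fun x => 1 / 2 *
        (densB m α x * potA n γ x + densA m α x * potB n γ x) - densC m α x * potC n γ x) :=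
      hAB.sub hC
    rw [integral_sub hABC hP, integral_sub hAB hC, integral_const_mul, integral_add hB hA]
  rw [h, h, integral_mul_antideriv (densB m α), integral_mul_antideriv (densA m α),
    integral_mul_antideriv (densC m α), integral_mul_antideriv (densP m α)]
  ring

theorem pairing_J_skew (m α β : STriple) :
    pairing α.fn (J m.fn β.fn) = -pairing β.fn (J m.fn α.fn) := by
  rw [J_fn, J_fn, pairing_polJ, pairing_polJ, integral_formDens_swap]

/-! ### The Jacobi identity -/

/-- The integrand of `⟨α, J'[v] γ⟩` after integration by parts: it is local in `v`. -/
noncomputable def derivDens (m α v γ : STriple) : 𝓢(ℝ, ℝ) :=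
  formDens v α m γ - formDens v γ m α

theorem pairing_JDeriv (m α v γ : STriple) :
    pairing α.fn (JDeriv m.fn v.fn γ.fn) = ∫ x, derivDens m α v γ x := by
  have h : pairing α.fn (STriple.fn (polJ v m γ + polJ m v γ)) =
      pairing α.fn (polJ v m γ).fn + pairing α.fn (polJ m v γ).fn := by
    simp only [pairing, STriple.fn, Pi.add_apply, add_apply, mul_add, Finset.sum_add_distrib]
    exact integral_add (integrable_sum_mul _ _) (integrable_sum_mul _ _)
  rw [JDeriv_fn, h, pairing_polJ, pairing_polJ, integral_formDens_swap m α v γ, ← sub_eq_add_neg]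
  simp only [derivDens, sub_apply]
  exact (integral_sub (SchwartzMap.integrable _) (SchwartzMap.integrable _)).symm

/-- One of three cyclically permuted rapidly decreasing terms in a primitive of the Jacobi
integrand. It arises from integrating by parts the derivative `(m P)'` inside the terms `a ∂⁻¹ b`. -/
noncomputable def jacobiTerm (m α β γ : STriple) : 𝓢(ℝ, ℝ) :=
  tmul (rotDens m α m γ - rotDens m γ m α) (potP m β)

/-- The determinant of the potentials `A, B, C` of three columns. -/
noncomputable def potDet (m α β γ : STriple) (x : ℝ) : ℝ :=
  potA m α x * (potB m β x * potC m γ x - potC m β x * potB m γ x) -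
    potB m α x * (potA m β x * potC m γ x - potC m β x * potA m γ x) +
    potC m α x * (potA m β x * potB m γ x - potB m β x * potA m γ x)

theorem D_densA_apply (m α : STriple) (x : ℝ) : D (densA m α) x =
    D (m 2) x * α 0 x + m 2 x * D (α 0) x - 2 * (D (m 0) x * α 1 x + m 0 x * D (α 1) x) := by
  simp only [densA, map_sub, map_smul, sub_apply, smul_apply, smul_eq_mul, D_tmul_apply]

theorem D_densB_apply (m α : STriple) (x : ℝ) : D (densB m α) x =
    D (m 1) x * α 0 x + m 1 x * D (α 0) x - 2 * (D (m 0) x * α 2 x + m 0 x * D (α 2) x) := by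
  simp only [densB, map_sub, map_smul, sub_apply, smul_apply, smul_eq_mul, D_tmul_apply]

theorem D_densC_apply (m α : STriple) (x : ℝ) : D (densC m α) x =
    D (m 1) x * α 1 x + m 1 x * D (α 1) x - (D (m 2) x * α 2 x + m 2 x * D (α 2) x) := by
  simp only [densC, map_sub, sub_apply, D_tmul_apply]

/-- In the derivative of `rotDens m α m γ - rotDens m γ m α`, the products of two of the densities
under `A, B, C` cancel, because the bilinear form behind `rotDens` is symmetric. -/
theorem hasDerivAt_jacobiTerm (m α β γ : STriple) (x : ℝ) :
    HasDerivAt (jacobiTerm m α β γ)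
      ((1 / 2 * (D (densB m α) x * potA m γ x + D (densA m α) x * potB m γ x) -
          D (densC m α) x * potC m γ x -
        (1 / 2 * (D (densB m γ) x * potA m α x + D (densA m γ) x * potB m α x) -
          D (densC m γ) x * potC m α x)) * potP m β x +
        (rotDens m α m γ x - rotDens m γ m α x) * densP m β x) x := by
  have h : D (jacobiTerm m α β γ) x = _ := D_tmul_antideriv _ _ x
  refine (hasDerivAt_D _ x).congr_deriv (h.trans ?_)
  simp only [rotDens, map_add, map_sub, map_smul, add_apply, sub_apply, smul_apply, smul_eq_mul,
    D_tmul_antideriv]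
  ring

theorem hasDerivAt_potDet (m α β γ : STriple) (x : ℝ) :
    HasDerivAt (potDet m α β γ)
      (densA m α x * (potB m β x * potC m γ x - potC m β x * potB m γ x) +
        potA m α x * (densB m β x * potC m γ x + potB m β x * densC m γ x -
          (densC m β x * potB m γ x + potC m β x * densB m γ x)) -
      (densB m α x * (potA m β x * potC m γ x - potC m β x * potA m γ x) +
        potB m α x * (densA m β x * potC m γ x + potA m β x * densC m γ x -
          (densC m β x * potA m γ x + potC m β x * densA m γ x))) +
      (densC m α x * (potA m β x * potB m γ x - potB m β x * potA m γ x) +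
        potC m α x * (densA m β x * potB m γ x + potA m β x * densB m γ x -
          (densB m β x * potA m γ x + potB m β x * densA m γ x)))) x := by
  have hA := fun α => hasDerivAt_antideriv (densA m α) x
  have hB := fun α => hasDerivAt_antideriv (densB m α) x
  have hC := fun α => hasDerivAt_antideriv (densC m α) x
  exact (((hA α).fun_mul (((hB β).fun_mul (hC γ)).fun_sub ((hC β).fun_mul (hB γ)))).fun_sub
    ((hB α).fun_mul (((hA β).fun_mul (hC γ)).fun_sub ((hC β).fun_mul (hA γ))))).fun_add
    ((hC α).fun_mul (((hA β).fun_mul (hB γ)).fun_sub ((hB β).fun_mul (hA γ))))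

/-- The sum of the three Jacobi integrands. -/
noncomputable def jacobiDens (m α β γ : STriple) : 𝓢(ℝ, ℝ) :=
  derivDens m α (polJ m m β) γ + derivDens m β (polJ m m γ) α + derivDens m γ (polJ m m α) β

/-- The Jacobi integrand is an exact derivative. Apart from the exact terms, the contributions with
`P` cancel in the cyclic sum, and those without `P` add up to `α · [M_γ, M_β] m` and its cyclic
permutations, which is `-1/2` times the derivative of the determinant of the potentials. -/
theorem hasDerivAt_jacobi (m α β γ : STriple) (x : ℝ) :
    HasDerivAt (fun x => (jacobiTerm m α β γ x + jacobiTerm m β γ α x + jacobiTerm m γ α β x) -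
      1 / 2 * potDet m α β γ x) (jacobiDens m α β γ x) x := by
  refine ((((hasDerivAt_jacobiTerm m α β γ x).fun_add (hasDerivAt_jacobiTerm m β γ α x)).fun_add
    (hasDerivAt_jacobiTerm m γ α β x)).fun_sub
    ((hasDerivAt_potDet m α β γ x).const_mul (1 / 2))).congr_deriv ?_
  simp only [jacobiDens, derivDens, add_apply, sub_apply, formDens_apply, rotDens_apply,
    D_densA_apply, D_densB_apply, D_densC_apply, densA_apply, densB_apply, densC_apply,
    densP_apply, polJ_zero_apply, polJ_one_apply, polJ_two_apply]
  ring

theorem neutral_fn_iff (m α : STriple) : Neutral m.fn α.fn ↔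
    (∫ x, densA m α x) = 0 ∧ (∫ x, densB m α x) = 0 ∧ (∫ x, densC m α x) = 0 := by
  simp only [densA_apply, densB_apply, densC_apply]
  exact Iff.rfl

/-- The potentials `A, B, C` of a neutral column vanish at `±∞`, while those of the other columns
stay bounded. -/
theorem tendsto_potDet (m α β γ : STriple)
    (h : Neutral m.fn α.fn ∨ Neutral m.fn β.fn ∨ Neutral m.fn γ.fn) :
    Tendsto (potDet m α β γ) atBot (𝓝 0) ∧ Tendsto (potDet m α β γ) atTop (𝓝 0) := by
  have hbot := fun f => tendsto_antideriv_atBot f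
  have htop := fun f => tendsto_antideriv_atTop f
  have h₁ := (((hbot (densA m α)).mul (((hbot (densB m β)).mul (hbot (densC m γ))).sub
      ((hbot (densC m β)).mul (hbot (densB m γ))))).sub
    ((hbot (densB m α)).mul (((hbot (densA m β)).mul (hbot (densC m γ))).sub
      ((hbot (densC m β)).mul (hbot (densA m γ)))))).add
    ((hbot (densC m α)).mul (((hbot (densA m β)).mul (hbot (densB m γ))).sub
      ((hbot (densB m β)).mul (hbot (densA m γ)))))
  have h₂ := (((htop (densA m α)).mul (((htop (densB m β)).mul (htop (densC m γ))).sub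
      ((htop (densC m β)).mul (htop (densB m γ))))).sub
    ((htop (densB m α)).mul (((htop (densA m β)).mul (htop (densC m γ))).sub
      ((htop (densC m β)).mul (htop (densA m γ)))))).add
    ((htop (densC m α)).mul (((htop (densA m β)).mul (htop (densB m γ))).sub
      ((htop (densB m β)).mul (htop (densA m γ)))))
  refine ⟨h₁.trans (le_of_eq (congrArg 𝓝 ?_)), h₂.trans (le_of_eq (congrArg 𝓝 ?_))⟩
  all_goals
    rcases h with h | h | h
    all_goals
      obtain ⟨hA, hB, hC⟩ := (neutral_fn_iff _ _).1 h
      rw [hA, hB, hC]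
      ring

theorem jacobi_identity (m α β γ : STriple)
    (h : Neutral m.fn α.fn ∨ Neutral m.fn β.fn ∨ Neutral m.fn γ.fn) :
    pairing α.fn (JDeriv m.fn (J m.fn β.fn) γ.fn) +
      pairing β.fn (JDeriv m.fn (J m.fn γ.fn) α.fn) +
      pairing γ.fn (JDeriv m.fn (J m.fn α.fn) β.fn) = 0 := by
  rw [J_fn, J_fn, J_fn, pairing_JDeriv, pairing_JDeriv, pairing_JDeriv]
  have hsum : (∫ x, derivDens m α (polJ m m β) γ x) + (∫ x, derivDens m β (polJ m m γ) α x) +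
      (∫ x, derivDens m γ (polJ m m α) β x) = ∫ x, jacobiDens m α β γ x := by
    simp only [jacobiDens, ← SchwartzMap.integralCLM_apply (𝕜 := ℝ), map_add]
  rw [hsum]
  obtain ⟨hbot, htop⟩ := tendsto_potDet m α β γ h
  have hb := tendsto_schwartz_atBot
  have ht := tendsto_schwartz_atTop
  rw [integral_of_hasDerivAt_of_tendsto (hasDerivAt_jacobi m α β γ) (SchwartzMap.integrable _)
    ((((hb _).add (hb _)).add (hb _)).sub (hbot.const_mul _))
    ((((ht _).add (ht _)).add (ht _)).sub (htop.const_mul _)), sub_self]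

/-! ### The Hamiltonian functional -/

/-- The momentum `u - u''` of a rapidly decreasing triple, as a rapidly decreasing triple. -/
noncomputable def smomentum (u : STriple) : STriple := fun k => u k - D (D (u k))

theorem smomentum_apply (u : STriple) (k : Fin 3) (x : ℝ) :
    smomentum u k x = u k x - D (D (u k)) x := sub_apply ..

theorem momentum_fn (u : STriple) : momentum u.fn = (smomentum u).fn := by
  funext k x
  rw [momentum, fn_apply, fn_apply, deriv_coe, deriv_coe, smomentum_apply]

/-- The polarised energy density
`u₁₁ w₁₁ + u₁₁' w₁₁' + (1/2) (u₁₂ w₂₁ + u₂₁ w₁₂ + u₁₂' w₂₁' + u₂₁' w₁₂')`. -/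
noncomputable def energyDens (u w : STriple) : 𝓢(ℝ, ℝ) :=
  tmul (u 0) (w 0) + tmul (D (u 0)) (D (w 0)) + (1 / 2 : ℝ) •
    (tmul (u 1) (w 2) + tmul (u 2) (w 1) + tmul (D (u 1)) (D (w 2)) + tmul (D (u 2)) (D (w 1)))

theorem energyDens_apply (u w : STriple) (x : ℝ) :
    energyDens u w x = u 0 x * w 0 x + D (u 0) x * D (w 0) x +
      1 / 2 * (u 1 x * w 2 x + u 2 x * w 1 x + D (u 1) x * D (w 2) x + D (u 2) x * D (w 1) x) := by
  simp only [energyDens, add_apply, smul_apply, smul_eq_mul, tmul_coe_apply]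

theorem H_smomentum (u : STriple) : H (smomentum u).fn = 1 / 2 * ∫ x, energyDens u u x := by
  have h : ∀ k, helmholtzInv ((smomentum u).fn k) = u k := fun k => helmholtzInv_helmholtz (u k)
  simp only [H, h, deriv_coe, energyDens_apply]
  congr 2
  funext x
  ring

/-- The variational derivative `(u₁₁, u₂₁/2, u₁₂/2)` of `H` at `m = u - u''`. -/
noncomputable def gradH (u : STriple) : STriple :=
  ![u 0, (1 / 2 : ℝ) • u 2, (1 / 2 : ℝ) • u 1]

theorem pairing_gradH (u w : STriple) :
    pairing (gradH u).fn (smomentum w).fn = ∫ x, energyDens u w x := by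
  let g : 𝓢(ℝ, ℝ) := tmul (u 0) (D (w 0)) +
    (1 / 2 : ℝ) • (tmul (u 1) (D (w 2)) + tmul (u 2) (D (w 1)))
  have hg : ∀ x, HasDerivAt g
      (D (u 0) x * D (w 0) x + u 0 x * D (D (w 0)) x +
        1 / 2 * ((D (u 1) x * D (w 2) x + u 1 x * D (D (w 2)) x) +
          (D (u 2) x * D (w 1) x + u 2 x * D (D (w 1)) x))) x := fun x => by
    rw [show (g : ℝ → ℝ) = fun x => u 0 x * D (w 0) x +
        1 / 2 * (u 1 x * D (w 2) x + u 2 x * D (w 1) x) by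
      funext y
      simp only [g, add_apply, smul_apply, smul_eq_mul, tmul_coe_apply]]
    exact ((hasDerivAt_D _ x).fun_mul (hasDerivAt_D _ x)).fun_add
      ((((hasDerivAt_D _ x).fun_mul (hasDerivAt_D _ x)).fun_add
        ((hasDerivAt_D _ x).fun_mul (hasDerivAt_D _ x))).const_mul _)
  have h : ∀ x, (∑ k, gradH u k x * smomentum w k x) = energyDens u w x - D g x := fun x => by
    rw [SchwartzMap.derivCLM_apply, (hg x).deriv, energyDens_apply, Fin.sum_univ_three]
    simp only [gradH, Matrix.cons_val, smul_apply, smul_eq_mul, smomentum_apply]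
    ring
  rw [pairing]
  simp only [STriple.fn, h]
  rw [integral_sub (SchwartzMap.integrable _) (SchwartzMap.integrable _),
    integral_eq_zero_of_hasDerivAt g (hasDerivAt_D g), sub_zero]

theorem isVariationalDerivative_gradH (u : STriple) :
    IsVariationalDerivative H (smomentum u).fn (gradH u).fn := by
  intro v
  choose w hw using fun k => exists_helmholtz_eq (v k)
  obtain rfl : v = smomentum w := funext hw
  have hshift : ∀ ε : ℝ, shift (smomentum u).fn (smomentum w).fn ε =
      (smomentum (u + ε • w)).fn := fun ε => by
    rw [shift_fn]
    congr 1
    funext k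
    simp only [smomentum, Pi.add_apply, Pi.smul_apply, map_add, map_smul]
    module
  have hE : ∀ ε : ℝ, energyDens (u + ε • w) (u + ε • w) =
      energyDens u u + ε • ((2 : ℝ) • energyDens u w) + (ε ^ 2) • energyDens w w := fun ε => by
    ext x
    simp only [energyDens_apply, add_apply, smul_apply, smul_eq_mul, Pi.add_apply, Pi.smul_apply,
      map_add, map_smul]
    ring
  have hH : (fun ε : ℝ => H (shift (smomentum u).fn (smomentum w).fn ε)) = fun ε : ℝ =>
      1 / 2 * (∫ x, energyDens u u x) + ε * (∫ x, energyDens u w x) +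
        ε ^ 2 * (1 / 2 * ∫ x, energyDens w w x) := by
    funext ε
    rw [hshift, H_smomentum, hE]
    simp only [← SchwartzMap.integralCLM_apply (𝕜 := ℝ), map_add, map_smul, smul_eq_mul]
    ring
  rw [hH, pairing_gradH]
  exact hasDerivAt_quadratic _ _ _

theorem IsVariationalDerivative.unique {F : Triple → ℝ} {m : Triple} {g g' : STriple}
    (h : IsVariationalDerivative F m g.fn) (h' : IsVariationalDerivative F m g'.fn) : g = g' := by
  have hp := (h (g - g')).unique (h' (g - g'))
  have h0 : ∫ x, ∑ k, (g k x - g' k x) ^ 2 = 0 := by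
    have hs : ∀ x, ∑ k, (g k x - g' k x) ^ 2 =
        (∑ k, g k x * (g - g') k x) - ∑ k, g' k x * (g - g') k x := fun x => by
      rw [← Finset.sum_sub_distrib]
      refine Finset.sum_congr rfl fun k _ => ?_
      rw [Pi.sub_apply, sub_apply]
      ring
    simp only [hs]
    rw [integral_sub (integrable_sum_mul _ _) (integrable_sum_mul _ _)]
    exact sub_eq_zero.2 hp
  have hc : Continuous fun x => ∑ k, (g k x - g' k x) ^ 2 :=
    continuous_finsetSum _ fun k _ => ((g k).continuous.sub (g' k).continuous).pow 2
  have hint : Integrable fun x => ∑ k, (g k x - g' k x) ^ 2 := by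
    refine (integrable_sum_mul (g - g') (g - g')).congr (Eventually.of_forall fun x => ?_)
    simp only [Pi.sub_apply, sub_apply, sq]
  have hz := (hc.ae_eq_iff_eq volume continuous_const).1 ((integral_eq_zero_iff_of_nonneg
    (fun x => Finset.sum_nonneg fun k _ => sq_nonneg (g k x - g' k x)) hint).1 h0)
  funext k
  ext x
  have hk := (Finset.sum_eq_zero_iff_of_nonneg fun k _ => sq_nonneg (g k x - g' k x)).1
    (congrFun hz x) k (Finset.mem_univ k)
  exact sub_eq_zero.1 (pow_eq_zero_iff two_ne_zero |>.1 hk)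

/-! ### The 3CH system as a Hamiltonian system -/

/-- The Wronskian `f' g - f g'`. -/
noncomputable def wronskian (f g : 𝓢(ℝ, ℝ)) : 𝓢(ℝ, ℝ) := tmul (D f) g - tmul f (D g)

theorem wronskian_apply (f g : 𝓢(ℝ, ℝ)) (x : ℝ) :
    wronskian f g x = D f x * g x - f x * D g x := by
  simp only [wronskian, sub_apply, tmul_coe_apply]

theorem hasDerivAt_wronskian (f g : 𝓢(ℝ, ℝ)) (x : ℝ) :
    HasDerivAt (wronskian f g) (f x * (g x - D (D g) x) - g x * (f x - D (D f) x)) x := by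
  rw [show (wronskian f g : ℝ → ℝ) = _ from funext (wronskian_apply f g)]
  refine (((hasDerivAt_D (D f) x).fun_mul (hasDerivAt_D g x)).fun_sub
    ((hasDerivAt_D f x).fun_mul (hasDerivAt_D (D g) x))).congr_deriv ?_
  ring

theorem gradH_apply (u : STriple) (x : ℝ) :
    gradH u 0 x = u 0 x ∧ gradH u 1 x = 1 / 2 * u 2 x ∧ gradH u 2 x = 1 / 2 * u 1 x :=
  ⟨rfl, rfl, rfl⟩

theorem hasDerivAt_wronskian_A (u : STriple) (x : ℝ) :
    HasDerivAt (wronskian (u 0) (u 2)) (densA (smomentum u) (gradH u) x) x := by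
  refine (hasDerivAt_wronskian _ _ x).congr_deriv ?_
  obtain ⟨h0, h1, h2⟩ := gradH_apply u x
  rw [densA_apply, h0, h1, smomentum_apply, smomentum_apply]
  ring

theorem hasDerivAt_wronskian_B (u : STriple) (x : ℝ) :
    HasDerivAt (wronskian (u 0) (u 1)) (densB (smomentum u) (gradH u) x) x := by
  refine (hasDerivAt_wronskian _ _ x).congr_deriv ?_
  obtain ⟨h0, h1, h2⟩ := gradH_apply u x
  rw [densB_apply, h0, h2, smomentum_apply, smomentum_apply]
  ring

theorem hasDerivAt_wronskian_C (u : STriple) (x : ℝ) :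
    HasDerivAt ((1 / 2 : ℝ) • wronskian (u 2) (u 1) : 𝓢(ℝ, ℝ))
      (densC (smomentum u) (gradH u) x) x := by
  refine ((hasDerivAt_wronskian (u 2) (u 1) x).const_mul (1 / 2)).congr_deriv ?_
  obtain ⟨h0, h1, h2⟩ := gradH_apply u x
  rw [densC_apply, h1, h2, smomentum_apply, smomentum_apply]
  ring

theorem potA_gradH (u : STriple) : potA (smomentum u) (gradH u) = wronskian (u 0) (u 2) :=
  antideriv_eq_of_hasDerivAt _ (hasDerivAt_wronskian_A u)

theorem potB_gradH (u : STriple) : potB (smomentum u) (gradH u) = wronskian (u 0) (u 1) :=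
  antideriv_eq_of_hasDerivAt _ (hasDerivAt_wronskian_B u)

theorem potC_gradH (u : STriple) :
    potC (smomentum u) (gradH u) = ((1 / 2 : ℝ) • wronskian (u 2) (u 1) : 𝓢(ℝ, ℝ)) :=
  antideriv_eq_of_hasDerivAt _ (hasDerivAt_wronskian_C u)

theorem neutral_gradH (u : STriple) : Neutral (smomentum u).fn (gradH u).fn :=
  (neutral_fn_iff _ _).2 ⟨integral_eq_zero_of_hasDerivAt _ (hasDerivAt_wronskian_A u),
    integral_eq_zero_of_hasDerivAt _ (hasDerivAt_wronskian_B u),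
    integral_eq_zero_of_hasDerivAt _ (hasDerivAt_wronskian_C u)⟩

/-- The function `Q` as a rapidly decreasing function. -/
noncomputable def sQ (u : STriple) : 𝓢(ℝ, ℝ) :=
  tmul (u 0) (u 0) - tmul (D (u 0)) (D (u 0)) + tmul (u 1) (u 2) - tmul (D (u 1)) (D (u 2))

theorem Q_fn (u : STriple) : Q u.fn = sQ u := by
  funext x
  simp only [Q, sQ, fn_apply, deriv_coe, add_apply, sub_apply, tmul_coe_apply, sq]

theorem D_gradH (u : STriple) (x : ℝ) :
    D (gradH u 0) x = D (u 0) x ∧ D (gradH u 1) x = 1 / 2 * D (u 2) x ∧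
      D (gradH u 2) x = 1 / 2 * D (u 1) x := by
  simp only [gradH, Matrix.cons_val, map_smul, smul_apply, smul_eq_mul, and_self]

theorem hasDerivAt_sQ (u : STriple) (x : ℝ) :
    HasDerivAt (sQ u) (2 * densP (smomentum u) (gradH u) x) x := by
  rw [show (sQ u : ℝ → ℝ) = fun x => u 0 x * u 0 x - D (u 0) x * D (u 0) x + u 1 x * u 2 x -
    D (u 1) x * D (u 2) x by
      funext y
      simp only [sQ, add_apply, sub_apply, tmul_coe_apply]]
  refine (((((hasDerivAt_D _ x).fun_mul (hasDerivAt_D _ x)).fun_sub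
    ((hasDerivAt_D _ x).fun_mul (hasDerivAt_D _ x))).fun_add
    ((hasDerivAt_D _ x).fun_mul (hasDerivAt_D _ x))).fun_sub
    ((hasDerivAt_D _ x).fun_mul (hasDerivAt_D _ x))).congr_deriv ?_
  obtain ⟨h0, h1, h2⟩ := D_gradH u x
  rw [densP_apply, h0, h1, h2, smomentum_apply, smomentum_apply, smomentum_apply]
  ring

theorem potP_gradH (u : STriple) :
    potP (smomentum u) (gradH u) = ((1 / 2 : ℝ) • sQ u : 𝓢(ℝ, ℝ)) := by
  refine antideriv_eq_of_hasDerivAt _ fun x =>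
    ((hasDerivAt_sQ u x).const_mul (1 / 2)).congr_deriv ?_
  ring

theorem rhs_eq_J_gradH (u : STriple) : rhs u.fn = J (momentum u.fn) (gradH u).fn := by
  rw [momentum_fn, J_fn]
  have hd : ∀ (k : Fin 3) (x : ℝ), deriv (fun y => smomentum u k y * sQ u y) x =
      D (smomentum u k) x * sQ u x +
        smomentum u k x * (2 * densP (smomentum u) (gradH u) x) := fun k x =>
    ((hasDerivAt_D _ x).fun_mul (hasDerivAt_sQ u x)).deriv
  funext k x
  fin_cases k
  all_goals
    simp only [rhs, momentum_fn, Q_fn, Fin.zero_eta, Fin.mk_one, Fin.reduceFinMk, Matrix.cons_val,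
      fn_apply, hd, deriv_coe, polJ_zero_apply, polJ_one_apply, polJ_two_apply, potP_gradH,
      potA_gradH, potB_gradH, potC_gradH, smul_apply, smul_eq_mul, wronskian_apply]
    ring

theorem solves3CH_iff (I : Set ℝ) (u : ℝ → STriple) :
    Solves3CH I u ↔ SolvesHamiltonianForm I u := by
  refine forall₂_congr fun t _ => ?_
  rw [rhs_eq_J_gradH]
  constructor
  · exact fun h => ⟨gradH (u t), momentum_fn (u t) ▸ isVariationalDerivative_gradH (u t), h⟩
  · rintro ⟨g, hg, h⟩
    rw [momentum_fn] at hg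
    rwa [← hg.unique (isVariationalDerivative_gradH (u t))]

end ThreeCH

theorem mainTheorem2 :
    -- `J` maps rapidly decreasing columns to rapidly decreasing columns
    (∀ m α : ThreeCH.STriple, ∃ w : ThreeCH.STriple, ThreeCH.J m.fn α.fn = w.fn) ∧
    -- the directional derivative `J'[v]` exists and has the same property
    (∀ m v γ : ThreeCH.STriple, ∃ w : ThreeCH.STriple, ∀ k x,
      HasDerivAt (fun ε : ℝ => ThreeCH.J (ThreeCH.shift m.fn v.fn ε) γ.fn k x) (w k x) 0) ∧
    -- `J` is skew-symmetric
    (∀ m α β : ThreeCH.STriple,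
      ThreeCH.pairing α.fn (ThreeCH.J m.fn β.fn) =
        -ThreeCH.pairing β.fn (ThreeCH.J m.fn α.fn)) ∧
    -- the Jacobi identity
    (∀ m α β γ : ThreeCH.STriple,
      (ThreeCH.Neutral m.fn α.fn ∨ ThreeCH.Neutral m.fn β.fn ∨ ThreeCH.Neutral m.fn γ.fn) →
      ThreeCH.pairing α.fn (ThreeCH.JDeriv m.fn (ThreeCH.J m.fn β.fn) γ.fn) +
      ThreeCH.pairing β.fn (ThreeCH.JDeriv m.fn (ThreeCH.J m.fn γ.fn) α.fn) +
      ThreeCH.pairing γ.fn (ThreeCH.JDeriv m.fn (ThreeCH.J m.fn α.fn) β.fn) = 0) ∧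
    -- the variational derivative of `H` exists, is unique, and is neutral
    (∀ u : ThreeCH.STriple,
      (∃! g : ThreeCH.STriple,
        ThreeCH.IsVariationalDerivative ThreeCH.H (ThreeCH.momentum u.fn) g.fn) ∧
      ∀ g : ThreeCH.STriple,
        ThreeCH.IsVariationalDerivative ThreeCH.H (ThreeCH.momentum u.fn) g.fn →
        ThreeCH.Neutral (ThreeCH.momentum u.fn) g.fn) ∧
    -- the 3CH system is the Hamiltonian system `m_t = J δH/δm`
    (∀ (I : Set ℝ) (u : ℝ → ThreeCH.STriple),
      ThreeCH.Solves3CH I u ↔ ThreeCH.SolvesHamiltonianForm I u) := by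
  refine ⟨fun m α => ⟨_, ThreeCH.J_fn m α⟩, fun m v γ => ⟨_, ThreeCH.hasDerivAt_J_shift m v γ⟩,
    ThreeCH.pairing_J_skew, ThreeCH.jacobi_identity, fun u => ?_, ThreeCH.solves3CH_iff⟩
  rw [ThreeCH.momentum_fn]
  have hu := ThreeCH.isVariationalDerivative_gradH u
  exact ⟨⟨ThreeCH.gradH u, hu, fun g hg => hg.unique hu⟩,
    fun g hg => hg.unique hu ▸ ThreeCH.neutral_gradH u⟩
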